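/- Let $d,n\in\mathbb N$, let $\mathbb T^d=\mathbb R^d/\mathbb Z^d$, and let $\omega\in\mathbb R^d$ be rationally independent, i.e. $\langle k,\omega\rangle\neq 0$ for all $k\in\mathbb Z^d\setminus\{0\}$. For a matrix-valued map $Z$ on $\mathbb T^d$ and $v\in\mathbb R^d$ write $\partial_v Z(\theta)=\frac{d}{dt}Z(\theta+tv)\big|_{t=0}$, and let $\bar B$ denote the entrywise complex conjugate of $B$. Let $B\in\mathcal M(n,\mathbb C)$ be in Jordan normal form and let $U:\mathbb T^d\to Gl(n,\mathbb C)$ be continuous and such that, for every $\theta\in\mathbb T^d$, the derivative $\partial_\omega U(\theta)$ exists and $$\partial_\omega U(\theta)=BU(\theta)-U(\theta)\bar B .$$ Then there exist a map $W:\mathbb T^d\to Gl(n,\mathbb C)$ of class $\mathcal C^\infty$, which is in fact a trigonometric polynomial (a finite sum $W(\theta)=\sum_k e^{2i\pi\langle k,\theta\rangle}C_k$ with $k\in\mathbb Z^d$ and $C_k\in\mathcal M(n,\mathbb C)$), and a real matrix $B'\in\mathcal M(n,\mathbb R)$ such that, for all $\theta\in\mathbb T^d$, $$\partial_{\frac{\omega}{2}}W(\theta)=BW(\theta)-W(\theta)B'.$$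 -/

import Mathlib

/-- `ω ∈ ℝ^d` is rationally independent: `⟨k, ω⟩ ≠ 0` for all `k ∈ ℤ^d \ {0}`. -/
def RationallyIndependent {d : ℕ} (ω : Fin d → ℝ) : Prop :=
  ∀ k : Fin d → ℤ, k ≠ 0 → ∑ i, (k i : ℝ) * ω i ≠ 0

/-- The projection `ℝ^d → 𝕋^d = ℝ^d / ℤ^d`. -/
def torusProj {d : ℕ} (x : Fin d → ℝ) : UnitAddTorus (Fin d) :=
  fun i => (x i : UnitAddCircle)

/-- `∂_ω Z (θ) = Z'`: the map `t ↦ Z (θ + t ω)` is differentiable at `t = 0` (entry by entry),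
with derivative the matrix `Z'`. -/
def HasFlowDerivAt {d n : ℕ} (ω : Fin d → ℝ)
    (Z : UnitAddTorus (Fin d) → Matrix (Fin n) (Fin n) ℂ)
    (Z' : Matrix (Fin n) (Fin n) ℂ) (θ : UnitAddTorus (Fin d)) : Prop :=
  ∀ i j, HasDerivAt (fun t : ℝ => Z (θ + torusProj (t • ω)) i j) (Z' i j) 0

/-- A matrix-valued map on `𝕋^d` is of class `C^∞`: the entries of its `ℤ^d`-periodic lift
to `ℝ^d` are. -/
def TorusSmooth {d n : ℕ} (Z : UnitAddTorus (Fin d) → Matrix (Fin n) (Fin n) ℂ) : Prop :=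
  ∀ i j, ContDiff ℝ ((⊤ : ℕ∞) : WithTop ℕ∞) (fun x : Fin d → ℝ => Z (torusProj x) i j)

/-- A matrix-valued map on `𝕋^d` is a trigonometric polynomial: a finite sum
`θ ↦ ∑ k ∈ s, e^{2iπ⟨k,θ⟩} c_k` with matrix coefficients. -/
def IsTrigPolynomial {d n : ℕ}
    (Z : UnitAddTorus (Fin d) → Matrix (Fin n) (Fin n) ℂ) : Prop :=
  ∃ (s : Finset (Fin d → ℤ)) (c : (Fin d → ℤ) → Matrix (Fin n) (Fin n) ℂ),
    ∀ θ, Z θ = ∑ k ∈ s, UnitAddTorus.mFourier k θ • c k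

/-- `B` is in (upper) Jordan normal form, i.e. block diagonal with Jordan blocks
(`α` on the diagonal, `1` on the superdiagonal, `0` elsewhere). Entrywise: `B` vanishes off the
diagonal and the superdiagonal, and each superdiagonal entry `B i (i+1)` is either `0` (a new block
begins at `i+1`) or `1` (`i` and `i+1` lie in the same block, so `B i i = B (i+1) (i+1)`). -/
def IsJordanNormalForm {n : ℕ} (B : Matrix (Fin n) (Fin n) ℂ) : Prop :=
  (∀ i j : Fin n, j ≠ i → (j : ℕ) ≠ i + 1 → B i j = 0) ∧
  (∀ i j : Fin n, (j : ℕ) = i + 1 → B i j = 0 ∨ (B i j = 1 ∧ B i i = B j j))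

/-! Write `B = diagonal α + N`, with `N` real, strictly upper triangular and linking only equal
eigenvalues. Each Fourier coefficient of `U` is an eigenvector of `A ↦ B A - A conj B` for `2πi⟨k,
ω⟩`, and triangularity forces its entry `(i, j)` to vanish unless `α i - conj (α j) = 2πi⟨k, ω⟩`.
Rational independence leaves at most one such `k`, so `X = U 0` commutes with `N` and links `α i` to
`conj (α j)` only modulo `G = 2πi⟨ℤ^d, ω⟩`.

Shift each eigenvalue `a` to `μ a` with `a - μ a ∈ G / 2`, so that equivalence modulo `G` becomes
equality and `M = diagonal (μ ∘ α) + N` satisfies `M X = X conj M`. The half is needed when `a -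
conj a ∈ G`: then `μ a = re a` and `a - μ a = (a - conj a) / 2`. This is why `ω / 2` appears.

The intertwiner `X` is corrected to `Z` with `Z conj Z = 1`. Hilbert 90 then gives `P` with `P⁻¹ M
P` real, and `W = D P`, where the diagonal matrix `D` of characters undoes the shift along `ω / 2`.
-/

/-! ### Fourier coefficients on the torus and differentiation along `ω`. -/

section Fourier

open MeasureTheory UnitAddTorus
open scoped Real ComplexConjugate

-- The normalized Haar measure, so that the integrals below are those defining `mFourierCoeff`.
noncomputable local instance : MeasureSpace UnitAddCircle := ⟨AddCircle.haarAddCircle⟩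

local instance : Measure.IsAddHaarMeasure (volume : Measure UnitAddCircle) :=
  inferInstanceAs (Measure.IsAddHaarMeasure AddCircle.haarAddCircle)

local instance : IsProbabilityMeasure (volume : Measure UnitAddCircle) :=
  inferInstanceAs (IsProbabilityMeasure AddCircle.haarAddCircle)

theorem torusProj_add {d : ℕ} (x y : Fin d → ℝ) :
    torusProj (x + y) = torusProj x + torusProj y := by
  ext i; simp [torusProj]

theorem torusProj_zero {d : ℕ} : torusProj (0 : Fin d → ℝ) = 0 := by
  ext i; simp [torusProj]

theorem mFourier_torusProj {d : ℕ} (k : Fin d → ℤ) (x : Fin d → ℝ) :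
    mFourier k (torusProj x) = Complex.exp (2 * π * Complex.I * ∑ i, (k i : ℂ) * x i) := by
  simp only [mFourier, ContinuousMap.coe_mk, torusProj, fourier_coe_apply, ← Complex.exp_sum,
    Finset.mul_sum]
  congr 1
  refine Finset.sum_congr rfl fun i _ => ?_
  simp; ring

theorem mFourier_add_apply {d : ℕ} (k : Fin d → ℤ) (x y : UnitAddTorus (Fin d)) :
    mFourier k (x + y) = mFourier k x * mFourier k y := by
  simp [mFourier, fourier_apply, AddCircle.toCircle_add, Finset.prod_mul_distrib]

theorem mFourier_conj_mul_self {d : ℕ} (k : Fin d → ℤ) (x : UnitAddTorus (Fin d)) :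
    mFourier (-k) x * mFourier k x = 1 := by
  rw [← mFourier_add, neg_add_cancel, mFourier_zero]; rfl

/-- The pairing `⟨k, ω⟩` of a frequency `k ∈ ℤ^d` with `ω ∈ ℝ^d`. -/
def freq {d : ℕ} (ω : Fin d → ℝ) : (Fin d → ℤ) →+ ℝ where
  toFun k := ∑ i, (k i : ℝ) * ω i
  map_zero' := by simp
  map_add' k l := by simp [add_mul, Finset.sum_add_distrib]

theorem mFourier_flow {d : ℕ} (ω : Fin d → ℝ) (k : Fin d → ℤ) (t : ℝ) :
    mFourier k (torusProj (t • ω)) = Complex.exp (2 * π * Complex.I * freq ω k * t) := by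
  rw [mFourier_torusProj]
  congr 1
  simp only [freq, AddMonoidHom.coe_mk, ZeroHom.coe_mk, Pi.smul_apply, smul_eq_mul]
  push_cast
  rw [mul_assoc (2 * (π : ℂ) * Complex.I), Finset.sum_mul]
  congr 1
  exact Finset.sum_congr rfl fun i _ => by ring

theorem hasDerivAt_mFourier_flow {d : ℕ} (ω : Fin d → ℝ) (k : Fin d → ℤ)
    (θ : UnitAddTorus (Fin d)) :
    HasDerivAt (fun t : ℝ => mFourier k (θ + torusProj (t • ω)))
      (2 * π * Complex.I * freq ω k * mFourier k θ) 0 := by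
  simp_rw [mFourier_add_apply, mFourier_flow]
  have h : HasDerivAt (fun t : ℝ => Complex.exp (2 * π * Complex.I * freq ω k * t))
      (2 * π * Complex.I * freq ω k) 0 := by
    have h1 : HasDerivAt (fun t : ℝ => (2 * π * Complex.I * freq ω k * t : ℂ))
        (2 * π * Complex.I * freq ω k) 0 := by
      simpa using (Complex.ofRealCLM.hasDerivAt (x := (0 : ℝ))).const_mul
        (2 * π * Complex.I * freq ω k : ℂ)
    simpa using h1.cexp
  simpa [mul_comm] using h.const_mul (mFourier k θ)

theorem mFourierCoeff_comp_add_right {d : ℕ} (f : UnitAddTorus (Fin d) → ℂ)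
    (k : Fin d → ℤ) (y : UnitAddTorus (Fin d)) :
    mFourierCoeff (fun x => f (x + y)) k = mFourier k y * mFourierCoeff f k := by
  unfold mFourierCoeff
  rw [← integral_add_right_eq_self (fun t => mFourier (-k) t • f t) y,
    ← integral_const_mul]
  congr 1
  ext x
  simp only [smul_eq_mul, mFourier_add_apply]
  linear_combination (- mFourier (-k) x * f (x + y)) * mFourier_conj_mul_self k y

theorem integrable_mFourier_smul {d : ℕ} {f : UnitAddTorus (Fin d) → ℂ} (hf : Continuous f)
    (k : Fin d → ℤ) : Integrable (fun t => mFourier k t • f t) (volume) :=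
  ((mFourier k).continuous.smul hf).integrable_of_hasCompactSupport
    (HasCompactSupport.of_compactSpace _)

/-- The Fourier coefficients of the derivative along `ω`. -/
theorem mFourierCoeff_flowDeriv {d : ℕ} (ω : Fin d → ℝ) {f g : UnitAddTorus (Fin d) → ℂ}
    (hf : Continuous f) (hg : Continuous g)
    (hfg : ∀ θ, HasDerivAt (fun t : ℝ => f (θ + torusProj (t • ω))) (g θ) 0)
    (k : Fin d → ℤ) :
    mFourierCoeff g k = 2 * π * Complex.I * freq ω k * mFourierCoeff f k := by
  have hderiv : ∀ θ (s : ℝ), HasDerivAt (fun t : ℝ => f (θ + torusProj (t • ω)))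
      (g (θ + torusProj (s • ω))) s := by
    intro θ s
    have h := hfg (θ + torusProj (s • ω))
    have h' := HasDerivAt.comp_sub_const (f := fun t : ℝ =>
      f (θ + torusProj (s • ω) + torusProj (t • ω))) s s (by simpa using h)
    refine h'.congr_of_eventuallyEq (Filter.Eventually.of_forall fun t => ?_)
    simp only [add_assoc, ← torusProj_add, ← add_smul, add_sub_cancel]
  obtain ⟨C, hC⟩ := (isCompact_range hg).isBounded.exists_norm_le
  have hcoe : ∀ (x : UnitAddTorus (Fin d)) l, ‖mFourier l x‖ ≤ 1 := fun x l =>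
    ((mFourier l).norm_coe_le_norm x).trans_eq mFourier_norm
  have hshift : ∀ t : ℝ, Continuous fun θ : UnitAddTorus (Fin d) => f (θ + torusProj (t • ω)) :=
    fun t => hf.comp (continuous_id.add continuous_const)
  -- Differentiate the `k`-th coefficient of the translate `f (· + t ω)` under the integral sign.
  -- Since translation multiplies it by a character, its derivative at `0` is also explicit.
  have key := (hasDerivAt_integral_of_dominated_loc_of_deriv_le (μ := volume)
    (F := fun (t : ℝ) θ => mFourier (-k) θ • f (θ + torusProj (t • ω)))
    (F' := fun (t : ℝ) θ => mFourier (-k) θ • g (θ + torusProj (t • ω)))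
    (x₀ := 0) (s := Set.univ) (bound := fun _ => C) Filter.univ_mem
    (Filter.Eventually.of_forall fun t =>
      (integrable_mFourier_smul (hshift t) _).aestronglyMeasurable)
    (integrable_mFourier_smul (hshift 0) _)
    (integrable_mFourier_smul
      (hg.comp (continuous_id.add continuous_const)) _).aestronglyMeasurable
    (Filter.Eventually.of_forall fun θ t _ => by
      rw [norm_smul]
      exact (mul_le_of_le_one_left (norm_nonneg _) (hcoe _ _)).trans (hC _ ⟨_, rfl⟩))
    (integrable_const C)
    (Filter.Eventually.of_forall fun θ t _ => by
      simpa only [smul_eq_mul] using (hderiv θ t).const_mul (mFourier (-k) θ))).2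
  have hleft : (fun t : ℝ => ∫ θ, mFourier (-k) θ • f (θ + torusProj (t • ω)))
      = fun t : ℝ => mFourier k (0 + torusProj (t • ω)) * mFourierCoeff f k := by
    ext t
    rw [zero_add, ← mFourierCoeff_comp_add_right]
    rfl
  rw [hleft] at key
  have h2 := (hasDerivAt_mFourier_flow ω k 0).mul_const (mFourierCoeff f k)
  have h0 : mFourier k (0 : UnitAddTorus (Fin d)) = 1 := by
    simp [mFourier]
  have := key.unique h2
  rw [h0, mul_one] at this
  rw [← this]
  simp [mFourierCoeff, torusProj_zero]

theorem mFourierCoeff_sum {d : ℕ} {ι : Type*} (s : Finset ι)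
    (f : ι → UnitAddTorus (Fin d) → ℂ) (hf : ∀ i ∈ s, Continuous (f i)) (k : Fin d → ℤ) :
    mFourierCoeff (fun x => ∑ i ∈ s, f i x) k = ∑ i ∈ s, mFourierCoeff (f i) k := by
  simp only [mFourierCoeff, Finset.smul_sum]
  exact integral_finsetSum s fun i hi => integrable_mFourier_smul (hf i hi) _

theorem mFourierCoeff_sub {d : ℕ} {f g : UnitAddTorus (Fin d) → ℂ} (hf : Continuous f)
    (hg : Continuous g) (k : Fin d → ℤ) :
    mFourierCoeff (fun x => f x - g x) k = mFourierCoeff f k - mFourierCoeff g k := by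
  simp only [mFourierCoeff, smul_sub]
  exact integral_sub (integrable_mFourier_smul hf _) (integrable_mFourier_smul hg _)

theorem mFourierCoeff_add {d : ℕ} {f g : UnitAddTorus (Fin d) → ℂ} (hf : Continuous f)
    (hg : Continuous g) (k : Fin d → ℤ) :
    mFourierCoeff (fun x => f x + g x) k = mFourierCoeff f k + mFourierCoeff g k := by
  simp only [mFourierCoeff, smul_add]
  exact integral_add (integrable_mFourier_smul hf _) (integrable_mFourier_smul hg _)

theorem mFourierCoeff_const_mul {d : ℕ} (f : UnitAddTorus (Fin d) → ℂ) (c : ℂ)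
    (k : Fin d → ℤ) :
    mFourierCoeff (fun x => c * f x) k = c * mFourierCoeff f k := by
  simp only [mFourierCoeff, smul_eq_mul]
  rw [← integral_const_mul]
  congr 1; ext x; ring

/-- A continuous function on the torus with only one nonzero Fourier coefficient takes
the value of that coefficient at the origin. -/
theorem apply_zero_eq_mFourierCoeff {d : ℕ} {f : UnitAddTorus (Fin d) → ℂ} (hf : Continuous f)
    (k : Fin d → ℤ) (hk : ∀ l ≠ k, mFourierCoeff f l = 0) :
    f 0 = mFourierCoeff f k := by
  -- A single nonzero coefficient makes the Fourier series summable, hence pointwise convergent to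
  -- `f`.
  have hs : Summable (mFourierCoeff (⟨f, hf⟩ : C(UnitAddTorus (Fin d), ℂ))) :=
    (hasSum_single k hk).summable
  have h := hasSum_mFourier_series_apply_of_summable hs 0
  have h2 : HasSum (fun i => mFourierCoeff (⟨f, hf⟩ : C(UnitAddTorus (Fin d), ℂ)) i •
      mFourier i (0 : UnitAddTorus (Fin d))) _ :=
    hasSum_single k fun l hl => by
      rw [show mFourierCoeff (⟨f, hf⟩ : C(UnitAddTorus (Fin d), ℂ)) l = 0 from hk l hl, zero_smul]
  have h0 : mFourier k (0 : UnitAddTorus (Fin d)) = 1 := by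
    simp [mFourier]
  rw [h0] at h2
  simpa using h.unique h2

end Fourier

/-! ### Antilinear involutions and real forms. -/

section RealForm

open scoped ComplexConjugate

theorem Matrix.map_conj_mul {ι : Type*} [Fintype ι] (A B : Matrix ι ι ℂ) :
    (A * B).map conj = A.map conj * B.map conj := Matrix.map_mul

theorem Matrix.map_conj_map_conj {ι : Type*} (A : Matrix ι ι ℂ) : (A.map conj).map conj = A := by
  ext; simp

theorem Matrix.map_conj_one {ι : Type*} [DecidableEq ι] : (1 : Matrix ι ι ℂ).map conj = 1 := by
  simp

variable {ι : Type*} [Fintype ι] [DecidableEq ι]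

/-- If `X` intertwines `M` with its conjugate and exchanges the supports of the projections
`p` and `q`, while `M` is real on the support of `e = 1 - p - q`, then `X` can be replaced by
an intertwining matrix `Z` for which `v ↦ Z (conj v)` is an involution. -/
theorem exists_involutive_intertwiner {M X Y e p q : Matrix ι ι ℂ}
    (hXY : X * Y = 1) (hYX : Y * X = 1) (hsum : e + p + q = 1)
    (hee : e * e = e) (hpp : p * p = p) (hqq : q * q = q)
    (hep : e * p = 0) (hpe : p * e = 0) (heq : e * q = 0) (hqe : q * e = 0)
    (hpq : p * q = 0) (hqp : q * p = 0)
    (hce : e.map conj = e) (hcp : p.map conj = p) (hcq : q.map conj = q)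
    (hXp : X * p = q * X) (hXq : X * q = p * X)
    (hMe : M * e = e * M.map conj) (hMp : M * p = p * M) (hMq : M * q = q * M)
    (hMX : M * X = X * M.map conj) :
    ∃ Z : Matrix ι ι ℂ, Z * Z.map conj = 1 ∧ M * Z = Z * M.map conj := by
  have hcXp : X.map conj * p = q * X.map conj := by
    have := congrArg (fun A : Matrix ι ι ℂ => A.map conj) hXp
    simpa only [Matrix.map_conj_mul, hcp, hcq] using this
  have hcXq : X.map conj * q = p * X.map conj := by
    have := congrArg (fun A : Matrix ι ι ℂ => A.map conj) hXq
    simpa only [Matrix.map_conj_mul, hcp, hcq] using this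
  have hcYX : Y.map conj * X.map conj = 1 := by
    rw [← Matrix.map_conj_mul, hYX, Matrix.map_conj_one]
  have hcMp : M.map conj * p = p * M.map conj := by
    have := congrArg (fun A : Matrix ι ι ℂ => A.map conj) hMp
    simpa only [Matrix.map_conj_mul, hcp] using this
  have hcMq : M.map conj * q = q * M.map conj := by
    have := congrArg (fun A : Matrix ι ι ℂ => A.map conj) hMq
    simpa only [Matrix.map_conj_mul, hcq] using this
  have hYM : Y * M = M.map conj * Y := by
    calc Y * M = Y * (M * X) * Y := by rw [mul_assoc, mul_assoc, hXY, mul_one]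
      _ = M.map conj * Y := by rw [hMX, ← mul_assoc, hYX, one_mul]
  have hcYM : M * Y.map conj = Y.map conj * M.map conj := by
    have := congrArg (fun A : Matrix ι ι ℂ => A.map conj) hYM
    simp only [Matrix.map_conj_mul, Matrix.map_conj_map_conj] at this
    exact this.symm
  -- `X conj X` need not be `1`. On `e` the identity already intertwines, as `M` is real there;
  -- between `p` and `q`, keep `X` one way and take its conjugate inverse the other way.
  refine ⟨e + p * X * q + q * Y.map conj * p, ?_, ?_⟩
  · have hc : (e + p * X * q + q * Y.map conj * p).map conj
        = e + p * X.map conj * q + q * Y * p := by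
      rw [Matrix.map_add _ (map_add _), Matrix.map_add _ (map_add _)]
      simp only [Matrix.map_conj_mul, hce, hcp, hcq, Matrix.map_conj_map_conj]
    have z : ∀ {a b : Matrix ι ι ℂ}, a * b = 0 → ∀ c, a * (b * c) = 0 := fun h c => by
      rw [← mul_assoc, h, zero_mul]
    have h1 : p * X * q * (q * Y * p) = p := by
      calc p * X * q * (q * Y * p) = p * (X * (q * q)) * Y * p := by simp only [mul_assoc]
        _ = p * p * (X * Y) * p := by rw [hqq, hXq]; simp only [mul_assoc]
        _ = p := by rw [hpp, hXY, mul_one, hpp]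
    have h2 : q * Y.map conj * p * (p * X.map conj * q) = q := by
      calc q * Y.map conj * p * (p * X.map conj * q)
          = q * Y.map conj * (p * p) * (X.map conj * q) := by simp only [mul_assoc]
        _ = q * Y.map conj * (p * p) * X.map conj := by
            rw [hpp, hcXq]; simp only [mul_assoc]; rw [← mul_assoc p p, hpp]
        _ = q * (Y.map conj * X.map conj) * q := by
            rw [hpp, mul_assoc _ p, ← hcXq]; simp only [mul_assoc]
        _ = q := by rw [hcYX, mul_one, hqq]
    rw [hc]
    have : (e + p * X * q + q * Y.map conj * p) * (e + p * X.map conj * q + q * Y * p)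
        = e * e + p * X * q * (q * Y * p) + q * Y.map conj * p * (p * X.map conj * q) := by
      simp only [mul_add, add_mul, mul_assoc, hpe, hqe, z hep, z heq, z hpq, z hqp,
        mul_zero, add_zero, zero_add]
      abel
    rw [this, hee, h1, h2, hsum]
  · have h1 : M * (p * X * q) = p * X * q * M.map conj := by
      rw [← mul_assoc, ← mul_assoc, hMp, mul_assoc p, hMX]
      simp only [mul_assoc, hcMq]
    have h2 : M * (q * Y.map conj * p) = q * Y.map conj * p * M.map conj := by
      rw [← mul_assoc, ← mul_assoc, hMq, mul_assoc q, hcYM]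
      simp only [mul_assoc, hcMp]
    rw [mul_add, mul_add, add_mul, add_mul, hMe, h1, h2]

/-- The determinant is a polynomial in `t`, nonzero because at `t = I` it equals `det (2 Z)`; its
finitely many roots cannot exhaust the reals. -/
theorem exists_real_det_ne_zero {Z : Matrix ι ι ℂ} (hZ : Z.det ≠ 0) :
    ∃ t : ℝ, ((1 + Complex.I * t) • (1 : Matrix ι ι ℂ) + (1 - Complex.I * t) • Z).det ≠ 0 := by
  open Polynomial in
  let q : ℂ[X] := ((1 + C Complex.I * X) • (1 : Matrix ι ι ℂ[X])
    + (1 - C Complex.I * X) • Z.map C).det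
  have hq : ∀ t : ℂ, q.eval t
      = ((1 + Complex.I * t) • (1 : Matrix ι ι ℂ) + (1 - Complex.I * t) • Z).det := by
    intro t
    change Polynomial.evalRingHom t q = _
    rw [RingHom.map_det]
    congr 1
    ext i j
    by_cases h : i = j <;> simp [h]
  have hq0 : q ≠ 0 := by
    intro h
    have := hq Complex.I
    rw [h, Polynomial.eval_zero, Complex.I_mul_I] at this
    norm_num [Matrix.det_smul, hZ] at this
  have hinf : (Set.range (fun t : ℝ => (t : ℂ))).Infinite :=
    Set.infinite_range_of_injective Complex.ofReal_injective
  obtain ⟨_, ⟨t, rfl⟩, ht⟩ := hinf.exists_notMem_finset q.roots.toFinset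
  refine ⟨t, fun h => ht ?_⟩
  rw [Multiset.mem_toFinset, Polynomial.mem_roots hq0, Polynomial.IsRoot, hq, h]

/-- **Hilbert 90** for `GL n` over `ℂ / ℝ`. -/
theorem exists_unit_mul_conj_eq {Z : Matrix ι ι ℂ} (hZ : Z * Z.map conj = 1) :
    ∃ P : GL ι ℂ, Z * (P : Matrix ι ι ℂ).map conj = P := by
  have hdet : Z.det ≠ 0 := by
    intro h
    have := congrArg Matrix.det hZ
    simp [h] at this
  obtain ⟨t, ht⟩ := exists_real_det_ne_zero hdet
  -- With `c = 1 + I t` and `P = c + conj c Z`, the relation `Z conj Z = 1` gives `Z conj P = conj c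
  -- Z + c = P`.
  refine ⟨Matrix.GeneralLinearGroup.mkOfDetNeZero _ ht, ?_⟩
  change Z * ((1 + Complex.I * t) • (1 : Matrix ι ι ℂ) + (1 - Complex.I * t) • Z).map conj
    = (1 + Complex.I * t) • (1 : Matrix ι ι ℂ) + (1 - Complex.I * t) • Z
  have : ((1 + Complex.I * t) • (1 : Matrix ι ι ℂ) + (1 - Complex.I * t) • Z).map conj
      = (1 - Complex.I * t) • (1 : Matrix ι ι ℂ) + (1 + Complex.I * t) • Z.map conj := by
    ext i j
    by_cases h : i = j <;> simp [h, sub_eq_add_neg]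
  rw [this, mul_add, mul_smul_comm, mul_smul_comm, hZ, mul_one, add_comm]

/-- A complex matrix commuting with an antilinear involution is similar to a real one. -/
theorem exists_similar_real {M Z : Matrix ι ι ℂ} (hZ : Z * Z.map conj = 1)
    (hMZ : M * Z = Z * M.map conj) :
    ∃ (P : GL ι ℂ) (R : Matrix ι ι ℝ),
      (P : Matrix ι ι ℂ) * R.map (fun a : ℝ => (a : ℂ)) = M * P := by
  obtain ⟨P, hP⟩ := exists_unit_mul_conj_eq hZ
  let P' : Matrix ι ι ℂ := (P⁻¹ : GL ι ℂ)
  have hPP' : (P : Matrix ι ι ℂ) * P' = 1 := by simp [P']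
  have hP'P : P' * (P : Matrix ι ι ℂ) = 1 := by simp [P']
  have hcP' : P'.map conj = P' * Z := by
    have h : P' * Z * (P : Matrix ι ι ℂ).map conj = 1 := by rw [mul_assoc, hP, hP'P]
    have h2 : (P : Matrix ι ι ℂ).map conj * P'.map conj = 1 := by
      rw [← Matrix.map_conj_mul, hPP', Matrix.map_conj_one]
    exact (left_inv_eq_right_inv h h2).symm
  have hreal : (P' * M * P).map conj = P' * M * P := by
    rw [Matrix.map_conj_mul, Matrix.map_conj_mul, hcP', mul_assoc P', ← hMZ, mul_assoc, mul_assoc M,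
      hP, mul_assoc]
  refine ⟨P, (P' * M * P).map Complex.re, ?_⟩
  have : ((P' * M * P).map Complex.re).map (fun a : ℝ => (a : ℂ)) = P' * M * P := by
    ext i j
    exact Complex.conj_eq_iff_re.1 (congrFun (congrFun hreal i) j)
  rw [this, ← mul_assoc, ← mul_assoc, hPP', one_mul]

end RealForm

/-! ### Shifting eigenvalues modulo `G / 2`. -/

section Shift

open scoped ComplexConjugate

/-- Eigenvalues can be moved by elements of `G / 2`, for a subgroup `G` of the imaginary axis,
so that classes modulo `G` collapse compatibly with complex conjugation. The sets `P`, `Q`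
separate each class from its conjugate, unless the two agree. -/
theorem exists_conj_compatible_shift (G : AddSubgroup ℂ) (hG : ∀ z ∈ G, z.re = 0) :
    ∃ (μ : ℂ → ℂ) (P Q : ℂ → Prop),
      (∀ a, 2 * (a - μ a) ∈ G) ∧
      (∀ a b, a - conj b ∈ G → μ a = conj (μ b) ∧ (P a ↔ Q b) ∧ (Q a ↔ P b)) ∧
      (∀ a, ¬ (P a ∧ Q a)) ∧ (∀ a, ¬ P a → ¬ Q a → conj (μ a) = μ a) := by
  classical
  have hGc : ∀ z, z ∈ G → conj z ∈ G := fun z hz => by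
    have : conj z = -z := by
      apply Complex.ext <;> simp [hG z hz]
    rw [this]; exact G.neg_mem hz
  let r : ℂ → ℂ := fun a => Quotient.out (QuotientAddGroup.mk a : ℂ ⧸ G)
  have hr : ∀ a, a - r a ∈ G := fun a => by
    have h : (QuotientAddGroup.mk (r a) : ℂ ⧸ G) = QuotientAddGroup.mk a :=
      Quotient.out_eq (QuotientAddGroup.mk a : ℂ ⧸ G)
    rw [QuotientAddGroup.eq] at h
    rwa [sub_eq_neg_add]
  have hrr : ∀ a b, a - b ∈ G → r a = r b := fun a b h => by
    have : (QuotientAddGroup.mk a : ℂ ⧸ G) = QuotientAddGroup.mk b := by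
      rw [QuotientAddGroup.eq]
      convert G.neg_mem h using 1; ring
    simp only [r, this]
  have hre : ∀ a, (r a).re = a.re := fun a => by
    have := hG _ (hr a)
    simp only [Complex.sub_re] at this
    linarith
  let S : ℂ → Prop := fun a => a - conj a ∈ G
  -- Representatives keep the real part, as `G` is imaginary, so distinct classes of `a` and `conj
  -- a` differ in imaginary part. Its order decides between `P` and `Q`.
  have hS : ∀ a, ¬ S a → (r a).im ≠ (r (conj a)).im := fun a ha h => ha <| by
    have h1 : r a = r (conj a) := Complex.ext (by rw [hre, hre, Complex.conj_re]) h
    have h2 := G.sub_mem (hr a) (hr (conj a))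
    rw [h1] at h2
    simpa using h2
  have hcc : ∀ a b, a - conj b ∈ G → conj a - b ∈ G := fun a b h => by simpa using hGc _ h
  have hSS : ∀ a b, a - conj b ∈ G → (S a ↔ S b) := fun a b h => by
    have h' := hcc a b h
    have e : a - conj a = (a - conj b) - (conj a - b) - (b - conj b) := by ring
    have e' : b - conj b = (a - conj b) - (conj a - b) - (a - conj a) := by ring
    constructor
    · intro hs
      change b - conj b ∈ G
      rw [e']; exact G.sub_mem (G.sub_mem h h') hs
    · intro hs
      change a - conj a ∈ G
      rw [e]; exact G.sub_mem (G.sub_mem h h') hs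
  let P : ℂ → Prop := fun a => ¬ S a ∧ (r a).im < (r (conj a)).im
  let Q : ℂ → Prop := fun a => ¬ S a ∧ (r (conj a)).im < (r a).im
  have hPQ : ∀ a, ¬ (P a ∧ Q a) := fun a h => lt_asymm h.1.2 h.2.2
  have hSPQ : ∀ a, ¬ P a → ¬ Q a → S a := fun a hp hq => by
    by_contra hs
    rcases lt_or_gt_of_ne (hS a hs) with h | h
    exacts [hp ⟨hs, h⟩, hq ⟨hs, h⟩]
  -- Self-conjugate classes go to the real axis. In a pair of conjugate classes, one uses its
  -- representative and the other the conjugate of that same representative.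
  let μ : ℂ → ℂ := fun a => if S a then (a.re : ℂ) else if P a then r a else conj (r (conj a))
  refine ⟨μ, P, Q, fun a => ?_, fun a b h => ?_, hPQ, fun a hp hq => ?_⟩
  · simp only [μ]
    split_ifs with hs hp
    · convert! (show a - conj a ∈ G from hs) using 1
      apply Complex.ext <;> simp; ring
    · rw [two_mul]; exact G.add_mem (hr a) (hr a)
    · have := hGc _ (hr (conj a))
      simp only [map_sub, Complex.conj_conj] at this
      rw [two_mul]; exact G.add_mem this this
  · have h1 : r a = r (conj b) := hrr _ _ h
    have h2 : r (conj a) = r b := hrr _ _ (hcc a b h)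
    have hs := hSS a b h
    have hP : P a ↔ Q b := by simp only [P, Q, h1, h2, hs]
    have hQ : Q a ↔ P b := by simp only [P, Q, h1, h2, hs]
    refine ⟨?_, hP, hQ⟩
    by_cases hsa : S a
    · have := hG _ h
      simp only [Complex.sub_re, Complex.conj_re] at this
      simp only [μ, if_pos hsa, if_pos (hs.1 hsa), Complex.conj_ofReal]
      rw [sub_eq_zero.1 this]
    · have hsb : ¬ S b := fun h => hsa (hs.2 h)
      by_cases hp : P a
      · have hpb : ¬ P b := fun h => hPQ b ⟨h, hP.1 hp⟩
        simp only [μ, if_neg hsa, if_neg hsb, if_pos hp, if_neg hpb, Complex.conj_conj, h1]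
      · have hpb : P b := by
          rw [← hQ]; by_contra hq; exact hsa (hSPQ a hp hq)
        simp only [μ, if_neg hsa, if_neg hsb, if_neg hp, if_pos hpb, h2]
  · simp only [μ, if_pos (hSPQ a hp hq), Complex.conj_ofReal]

end Shift

/-! ### Structure of `U 0` and the intertwiner of the shifted matrix. -/

section Intertwiner

open UnitAddTorus
open scoped Real ComplexConjugate

/-- If `A` is an eigenvector of `A ↦ B A - A conj B`, where `B` is the sum of a diagonal matrix and
a strictly upper triangular matrix commuting with it, then `A` is an eigenvector of the diagonal
part of this operator. -/
theorem intertwiner_entry_eq_zero {n : ℕ} {α : Fin n → ℂ} {N A : Matrix (Fin n) (Fin n) ℂ}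
    (hN : ∀ i j, N i j ≠ 0 → i < j ∧ α i = α j) {c : ℂ}
    (hA : ∀ i j, (α i - conj (α j)) * A i j + ((N * A) i j - (A * N) i j) = c * A i j)
    (i j : Fin n) (hc : α i - conj (α j) ≠ c) : A i j = 0 := by
  -- Left multiplication by `N` calls on lower rows and right multiplication on columns further
  -- left; both decrease `n - i + j` and leave `α i - conj (α j)` unchanged.
  induction hm : n - (i : ℕ) + j using Nat.strong_induction_on generalizing i j with
  | _ m ih =>
    have h1 : (N * A) i j = 0 := by
      rw [Matrix.mul_apply]
      refine Finset.sum_eq_zero fun l _ => ?_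
      by_cases hl : N i l = 0
      · rw [hl, zero_mul]
      · obtain ⟨hlt, he⟩ := hN i l hl
        rw [ih (n - (l : ℕ) + j) (by omega) l j (he ▸ hc) rfl, mul_zero]
    have h2 : (A * N) i j = 0 := by
      rw [Matrix.mul_apply]
      refine Finset.sum_eq_zero fun l _ => ?_
      by_cases hl : N l j = 0
      · rw [hl, mul_zero]
      · obtain ⟨hlt, he⟩ := hN l j hl
        rw [ih (n - (i : ℕ) + l) (by omega) i l (he ▸ hc) rfl, zero_mul]
    have h := hA i j
    rw [h1, h2, sub_zero, add_zero] at h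
    exact (mul_eq_mul_right_iff.1 h).resolve_left hc

/-- The value at the origin of a continuous solution `U` of `∂_ω U = B U - U (conj B)`. -/
theorem apply_zero_commutes_and_support {d n : ℕ} {ω : Fin d → ℝ} (hω : RationallyIndependent ω)
    {α : Fin n → ℂ} {N : Matrix (Fin n) (Fin n) ℂ}
    (hN : ∀ i j, N i j ≠ 0 → i < j ∧ α i = α j) (hNc : N.map conj = N)
    {U : UnitAddTorus (Fin d) → Matrix (Fin n) (Fin n) ℂ} (hU : Continuous U)
    (hUB : ∀ θ, HasFlowDerivAt ω U ((Matrix.diagonal α + N) * U θ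
      - U θ * (Matrix.diagonal α + N).map conj) θ) :
    N * U 0 = U 0 * N ∧
      ∀ i j, U 0 i j ≠ 0 → ∃ k, α i - conj (α j) = 2 * π * Complex.I * freq ω k := by
  have hinj : Function.Injective (freq ω) := by
    rw [injective_iff_map_eq_zero]
    intro k hk
    by_contra h
    exact hω k h hk
  have hUc : ∀ i j, Continuous fun θ => U θ i j := fun i j => hU.matrix_elem i j
  let A : (Fin d → ℤ) → Matrix (Fin n) (Fin n) ℂ :=
    fun k => Matrix.of fun i j => mFourierCoeff (fun θ => U θ i j) k
  have hfun : ∀ θ i j, ((Matrix.diagonal α + N) * U θ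
      - U θ * (Matrix.diagonal α + N).map conj) i j
      = (α i - conj (α j)) * U θ i j
        + ((∑ l, N i l * U θ l j) - ∑ l, N l j * U θ i l) := by
    intro θ i j
    have h1 : (Matrix.diagonal α + N).map conj = Matrix.diagonal (fun i => conj (α i)) + N := by
      rw [Matrix.map_add _ (map_add _), hNc, Matrix.diagonal_map (map_zero _)]
    rw [h1, add_mul, mul_add, Matrix.sub_apply, Matrix.add_apply, Matrix.add_apply,
      Matrix.diagonal_mul, Matrix.mul_diagonal, Matrix.mul_apply, Matrix.mul_apply]
    simp only [mul_comm (N _ j)]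
    ring
  have hcl : ∀ i j, Continuous fun θ => ∑ l, N i l * U θ l j := fun i j =>
    continuous_finsetSum _ fun l _ => continuous_const.mul (hUc l j)
  have hcr : ∀ i j, Continuous fun θ => ∑ l, N l j * U θ i l := fun i j =>
    continuous_finsetSum _ fun l _ => continuous_const.mul (hUc i l)
  have hA : ∀ k i j, (α i - conj (α j)) * A k i j + ((N * A k) i j - (A k * N) i j)
      = 2 * π * Complex.I * freq ω k * A k i j := by
    intro k i j
    have h := mFourierCoeff_flowDeriv ω (hUc i j)
      (g := fun θ => (α i - conj (α j)) * U θ i j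
        + ((∑ l, N i l * U θ l j) - ∑ l, N l j * U θ i l))
      ((continuous_const.mul (hUc i j)).add ((hcl i j).sub (hcr i j)))
      (fun θ => by rw [← hfun]; exact hUB θ i j) k
    rw [mFourierCoeff_add (f := fun θ => (α i - conj (α j)) * U θ i j)
        (g := fun θ => (∑ l, N i l * U θ l j) - ∑ l, N l j * U θ i l)
        (continuous_const.mul (hUc i j)) ((hcl i j).sub (hcr i j)),
      mFourierCoeff_sub (hcl i j) (hcr i j), mFourierCoeff_const_mul,
      mFourierCoeff_sum _ (fun l θ => N i l * U θ l j) fun l _ => continuous_const.mul (hUc l j),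
      mFourierCoeff_sum _ (fun l θ => N l j * U θ i l) fun l _ => continuous_const.mul (hUc i l)] at h
    simp only [mFourierCoeff_const_mul] at h
    rw [Matrix.mul_apply, Matrix.mul_apply]
    simp only [mul_comm (A k _ _) (N _ j)]
    exact h
  have hzero : ∀ k i j, α i - conj (α j) ≠ 2 * π * Complex.I * freq ω k → A k i j = 0 :=
    fun k i j => intertwiner_entry_eq_zero hN (hA k) i j
  have hval : ∀ i j k, α i - conj (α j) = 2 * π * Complex.I * freq ω k → U 0 i j = A k i j := by
    intro i j k hk
    refine apply_zero_eq_mFourierCoeff (hUc i j) k fun l hl => hzero l i j fun h => hl ?_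
    rw [hk] at h
    exact (hinj (by simpa [Real.pi_ne_zero] using h)).symm
  have hnone : ∀ i j, (¬ ∃ k, α i - conj (α j) = 2 * π * Complex.I * freq ω k) → U 0 i j = 0 := by
    intro i j hk
    rw [not_exists] at hk
    -- All coefficients vanish here, so the frequency `0` is an arbitrary choice.
    rw [apply_zero_eq_mFourierCoeff (hUc i j) 0 fun l _ => hzero l i j (hk l)]
    exact hzero 0 i j (hk 0)
  refine ⟨?_, fun i j h => by_contra fun hk => h (hnone i j hk)⟩
  ext i j
  by_cases hk : ∃ k, α i - conj (α j) = 2 * π * Complex.I * freq ω k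
  · obtain ⟨k, hk⟩ := hk
    -- `N` links only equal eigenvalues, so every entry of `U 0` involved is a coefficient at the
    -- same `k`.
    have h1 : (N * U 0) i j = (N * A k) i j := by
      rw [Matrix.mul_apply, Matrix.mul_apply]
      refine Finset.sum_congr rfl fun l _ => ?_
      by_cases hl : N i l = 0
      · simp [hl]
      · rw [hval l j k ((hN i l hl).2 ▸ hk)]
    have h2 : (U 0 * N) i j = (A k * N) i j := by
      rw [Matrix.mul_apply, Matrix.mul_apply]
      refine Finset.sum_congr rfl fun l _ => ?_
      by_cases hl : N l j = 0
      · simp [hl]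
      · rw [hval i l k ((hN l j hl).2 ▸ hk)]
    have h := hA k i j
    rw [hk, add_eq_left, sub_eq_zero] at h
    rw [h1, h2, h]
  · have h1 : (N * U 0) i j = 0 := by
      rw [Matrix.mul_apply]
      refine Finset.sum_eq_zero fun l _ => ?_
      by_cases hl : N i l = 0
      · simp [hl]
      · rw [hnone l j ((hN i l hl).2 ▸ hk), mul_zero]
    have h2 : (U 0 * N) i j = 0 := by
      rw [Matrix.mul_apply]
      refine Finset.sum_eq_zero fun l _ => ?_
      by_cases hl : N l j = 0
      · simp [hl]
      · rw [hnone i l ((hN l j hl).2 ▸ hk), zero_mul]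
    rw [h1, h2]

open Classical in
/-- The diagonal projection onto the coordinates whose eigenvalue satisfies `T`. -/
noncomputable def spectralIndicator {n : ℕ} (α : Fin n → ℂ) (T : ℂ → Prop) :
    Matrix (Fin n) (Fin n) ℂ :=
  Matrix.diagonal fun i => if T (α i) then 1 else 0

theorem spectralIndicator_mul_self {n : ℕ} (α : Fin n → ℂ) (T : ℂ → Prop) :
    spectralIndicator α T * spectralIndicator α T = spectralIndicator α T := by
  simp [spectralIndicator]

theorem spectralIndicator_mul_eq_zero {n : ℕ} (α : Fin n → ℂ) {S T : ℂ → Prop}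
    (h : ∀ a, ¬ (S a ∧ T a)) : spectralIndicator α S * spectralIndicator α T = 0 := by
  rw [spectralIndicator, spectralIndicator, Matrix.diagonal_mul_diagonal,
    ← Matrix.diagonal_zero]
  congr 1; ext i
  have := h (α i)
  by_cases hS : S (α i) <;> simp_all

theorem spectralIndicator_map_conj {n : ℕ} (α : Fin n → ℂ) (T : ℂ → Prop) :
    (spectralIndicator α T).map conj = spectralIndicator α T := by
  rw [spectralIndicator, Matrix.diagonal_map (map_zero _)]
  simp only [apply_ite conj, map_one, map_zero]

/-- An invertible matrix that commutes with the nilpotent part `N` and relates each eigenvalue to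
the conjugates of equivalent ones makes a shifted matrix similar to a real one. -/
theorem exists_shift_similar_real {n : ℕ} (G : AddSubgroup ℂ) (hG : ∀ z ∈ G, z.re = 0)
    {α : Fin n → ℂ} {N X Y : Matrix (Fin n) (Fin n) ℂ}
    (hN : ∀ i j, N i j ≠ 0 → α i = α j) (hNc : N.map conj = N)
    (hXY : X * Y = 1) (hYX : Y * X = 1) (hNX : N * X = X * N)
    (hX : ∀ i j, X i j ≠ 0 → α i - conj (α j) ∈ G) :
    ∃ (μ : ℂ → ℂ) (P : GL (Fin n) ℂ) (R : Matrix (Fin n) (Fin n) ℝ),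
      (∀ a, 2 * (a - μ a) ∈ G) ∧
      (P : Matrix (Fin n) (Fin n) ℂ) * R.map (fun a : ℝ => (a : ℂ))
        = (Matrix.diagonal (fun i => μ (α i)) + N) * P := by
  classical
  obtain ⟨μ, P, Q, hμ, hμc, hPQ, hreal⟩ := exists_conj_compatible_shift G hG
  let E : ℂ → Prop := fun a => ¬ P a ∧ ¬ Q a
  have hNind : ∀ T, N * spectralIndicator α T = spectralIndicator α T * N := by
    intro T
    ext i j
    rw [spectralIndicator, Matrix.mul_diagonal, Matrix.diagonal_mul]
    by_cases h : N i j = 0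
    · simp [h]
    · rw [hN i j h, mul_comm]
  have hMind : ∀ T, (Matrix.diagonal (fun i => μ (α i)) + N) * spectralIndicator α T
      = spectralIndicator α T * (Matrix.diagonal (fun i => μ (α i)) + N) := by
    intro T
    rw [add_mul, mul_add, hNind]
    simp only [spectralIndicator, Matrix.diagonal_mul_diagonal, mul_comm]
  have hXind : ∀ S T : ℂ → Prop, (∀ a b, a - conj b ∈ G → (S a ↔ T b)) →
      X * spectralIndicator α T = spectralIndicator α S * X := by
    intro S T h
    ext i j
    rw [spectralIndicator, spectralIndicator, Matrix.mul_diagonal, Matrix.diagonal_mul]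
    by_cases hx : X i j = 0
    · simp [hx]
    · simp only [h _ _ (hX i j hx), mul_comm]
  have hMc : (Matrix.diagonal (fun i => μ (α i)) + N).map conj
      = Matrix.diagonal (fun i => conj (μ (α i))) + N := by
    rw [Matrix.map_add _ (map_add _), hNc, Matrix.diagonal_map (map_zero _)]
  have hMe : (Matrix.diagonal (fun i => μ (α i)) + N) * spectralIndicator α E
      = spectralIndicator α E * (Matrix.diagonal (fun i => μ (α i)) + N).map conj := by
    refine (hMind _).trans ?_
    rw [hMc, mul_add, mul_add]
    simp only [spectralIndicator, Matrix.diagonal_mul_diagonal]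
    congr 2; ext i
    by_cases h : E (α i)
    · rw [hreal _ h.1 h.2]
    · simp only [h, if_false, zero_mul]
  obtain ⟨Z, hZ, hMZ⟩ := exists_involutive_intertwiner
    (M := Matrix.diagonal (fun i => μ (α i)) + N)
    (e := spectralIndicator α E) (p := spectralIndicator α P) (q := spectralIndicator α Q) hXY hYX
    (by
      simp only [spectralIndicator, Matrix.diagonal_add, ← Matrix.diagonal_one]
      congr 1; ext i
      have := hPQ (α i)
      by_cases h : P (α i) <;> by_cases h' : Q (α i) <;> simp_all [E])
    (spectralIndicator_mul_self _ _) (spectralIndicator_mul_self _ _)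
    (spectralIndicator_mul_self _ _)
    (spectralIndicator_mul_eq_zero α fun a h => h.1.1 h.2)
    (spectralIndicator_mul_eq_zero α fun a h => h.2.1 h.1)
    (spectralIndicator_mul_eq_zero α fun a h => h.1.2 h.2)
    (spectralIndicator_mul_eq_zero α fun a h => h.2.2 h.1)
    (spectralIndicator_mul_eq_zero α hPQ)
    (spectralIndicator_mul_eq_zero α fun a h => hPQ a (And.symm h))
    (spectralIndicator_map_conj _ _) (spectralIndicator_map_conj _ _)
    (spectralIndicator_map_conj _ _)
    (hXind Q P fun a b h => (hμc a b h).2.2)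
    (hXind P Q fun a b h => (hμc a b h).2.1)
    hMe (hMind _) (hMind _)
    (by
      rw [hMc, add_mul, mul_add, hNX]
      congr 1
      ext i j
      rw [Matrix.mul_diagonal, Matrix.diagonal_mul]
      by_cases hx : X i j = 0
      · simp [hx]
      · rw [(hμc _ _ (hX i j hx)).1, mul_comm])
  obtain ⟨P', R, h⟩ := exists_similar_real hZ hMZ
  exact ⟨μ, P', R, hμ, h⟩

end Intertwiner

/-! ### Construction of `W`. -/

section Main

open UnitAddTorus
open scoped Real ComplexConjugate

theorem contDiff_mFourier_torusProj {d : ℕ} (k : Fin d → ℤ) {m : WithTop ℕ∞} :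
    ContDiff ℝ m fun x : Fin d → ℝ => mFourier k (torusProj x) := by
  simp_rw [mFourier_torusProj]
  refine ContDiff.cexp (contDiff_const.mul (ContDiff.sum fun i _ => contDiff_const.mul ?_))
  exact Complex.ofRealCLM.contDiff.comp (contDiff_apply ℝ ℝ i)

/-- The invertible matrix `diag (e^{2iπ⟨k_i, θ⟩}) P`. -/
noncomputable def monomialFrame {d n : ℕ} (k : Fin n → Fin d → ℤ) (P : GL (Fin n) ℂ)
    (θ : UnitAddTorus (Fin d)) : GL (Fin n) ℂ :=
  Matrix.GeneralLinearGroup.mkOfDetNeZero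
    (Matrix.diagonal (fun i => mFourier (k i) θ) * (P : Matrix (Fin n) (Fin n) ℂ)) <| by
    rw [Matrix.det_mul, Matrix.det_diagonal]
    refine mul_ne_zero (Finset.prod_ne_zero_iff.2 fun i _ => ?_)
      ((Matrix.isUnit_iff_isUnit_det _).1 P.isUnit).ne_zero
    exact right_ne_zero_of_mul (mFourier_conj_mul_self (k i) θ ▸ one_ne_zero)

theorem monomialFrame_apply {d n : ℕ} (k : Fin n → Fin d → ℤ) (P : GL (Fin n) ℂ)
    (θ : UnitAddTorus (Fin d)) (i j : Fin n) :
    (monomialFrame k P θ : Matrix (Fin n) (Fin n) ℂ) i j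
      = mFourier (k i) θ * (P : Matrix (Fin n) (Fin n) ℂ) i j :=
  Matrix.diagonal_mul _ _ _ _

theorem torusSmooth_monomialFrame {d n : ℕ} (k : Fin n → Fin d → ℤ) (P : GL (Fin n) ℂ) :
    TorusSmooth fun θ => (monomialFrame k P θ : Matrix (Fin n) (Fin n) ℂ) := by
  intro i j
  simp only [monomialFrame_apply]
  exact (contDiff_mFourier_torusProj (k i)).mul contDiff_const

theorem isTrigPolynomial_monomialFrame {d n : ℕ} (k : Fin n → Fin d → ℤ) (P : GL (Fin n) ℂ) :
    IsTrigPolynomial fun θ => (monomialFrame k P θ : Matrix (Fin n) (Fin n) ℂ) := by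
  classical
  refine ⟨Finset.univ.image k, fun l => Matrix.of fun i j =>
    if k i = l then (P : Matrix (Fin n) (Fin n) ℂ) i j else 0, fun θ => ?_⟩
  ext i j
  refine (monomialFrame_apply k P θ i j).trans ?_
  rw [Matrix.sum_apply, Finset.sum_eq_single (k i)]
  · simp
  · intro l _ hl
    simp [hl.symm]
  · intro h
    exact absurd (Finset.mem_image_of_mem k (Finset.mem_univ i)) h

theorem hasFlowDerivAt_monomialFrame {d n : ℕ} (ω : Fin d → ℝ) (k : Fin n → Fin d → ℤ)
    (P : GL (Fin n) ℂ) (θ : UnitAddTorus (Fin d)) :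
    HasFlowDerivAt ω (fun θ => (monomialFrame k P θ : Matrix (Fin n) (Fin n) ℂ))
      (Matrix.diagonal (fun i => 2 * π * Complex.I * freq ω (k i)) * monomialFrame k P θ) θ := by
  intro i j
  rw [Matrix.diagonal_mul]
  simp only [monomialFrame_apply]
  rw [← mul_assoc]
  exact (hasDerivAt_mFourier_flow ω (k i) θ).mul_const _

/-- The diagonal and superdiagonal parts of a matrix in Jordan normal form. -/
theorem IsJordanNormalForm.exists_diagonal_add {n : ℕ} {B : Matrix (Fin n) (Fin n) ℂ}
    (hB : IsJordanNormalForm B) :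
    ∃ (α : Fin n → ℂ) (N : Matrix (Fin n) (Fin n) ℂ), B = Matrix.diagonal α + N ∧
      (∀ i j, N i j ≠ 0 → i < j ∧ α i = α j) ∧ N.map conj = N := by
  have hsup : ∀ i j : Fin n, i ≠ j → B i j ≠ 0 → (j : ℕ) = i + 1 := fun i j hij h =>
    by_contra fun h' => h (hB.1 i j (Ne.symm hij) h')
  refine ⟨fun i => B i i, B - Matrix.diagonal fun i => B i i, by simp, fun i j h => ?_, ?_⟩
  · by_cases hij : i = j
    · simp [hij] at h
    · rw [Matrix.sub_apply, Matrix.diagonal_apply_ne _ hij, sub_zero] at h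
      have hj := hsup i j hij h
      exact ⟨Fin.lt_def.2 (by omega), ((hB.2 i j hj).resolve_left h).2⟩
  · ext i j
    by_cases hij : i = j
    · simp [hij]
    · rw [Matrix.map_apply, Matrix.sub_apply, Matrix.diagonal_apply_ne _ hij, sub_zero]
      by_cases h : B i j = 0
      · simp [h]
      · simp [((hB.2 i j (hsup i j hij h)).resolve_left h).1]

theorem mainTheorem7 (d n : ℕ) (ω : Fin d → ℝ) (hω : RationallyIndependent ω)
    (B : Matrix (Fin n) (Fin n) ℂ) (hB : IsJordanNormalForm B)
    (U : UnitAddTorus (Fin d) → GL (Fin n) ℂ) (hU : Continuous U)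
    (hUB : ∀ θ, HasFlowDerivAt ω (fun x => (U x : Matrix (Fin n) (Fin n) ℂ))
      (B * (U θ : Matrix (Fin n) (Fin n) ℂ)
        - (U θ : Matrix (Fin n) (Fin n) ℂ) * B.map (starRingEnd ℂ)) θ) :
    ∃ (W : UnitAddTorus (Fin d) → GL (Fin n) ℂ) (B' : Matrix (Fin n) (Fin n) ℝ),
      TorusSmooth (fun x => (W x : Matrix (Fin n) (Fin n) ℂ)) ∧
      IsTrigPolynomial (fun x => (W x : Matrix (Fin n) (Fin n) ℂ)) ∧
      ∀ θ, HasFlowDerivAt ((1 / 2 : ℝ) • ω) (fun x => (W x : Matrix (Fin n) (Fin n) ℂ))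
        (B * (W θ : Matrix (Fin n) (Fin n) ℂ)
          - (W θ : Matrix (Fin n) (Fin n) ℂ) * B'.map (fun a : ℝ => (a : ℂ))) θ := by
  obtain ⟨α, N, rfl, hN, hNc⟩ := hB.exists_diagonal_add
  obtain ⟨hNX, hX⟩ := apply_zero_commutes_and_support hω hN hNc
    (Units.continuous_val.comp hU) hUB
  let G : AddSubgroup ℂ := ((AddMonoidHom.mulLeft (2 * π * Complex.I : ℂ)).comp
    (Complex.ofRealHom.toAddMonoidHom.comp (freq ω))).range
  have hG : ∀ z, z ∈ G ↔ ∃ k, 2 * π * Complex.I * freq ω k = z := fun z => Iff.rfl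
  obtain ⟨μ, P, R, hμ, hPR⟩ := exists_shift_similar_real G
    (fun z hz => by
      obtain ⟨k, rfl⟩ := (hG z).1 hz
      simp)
    (fun i j h => (hN i j h).2) hNc
    (X := (U 0 : Matrix (Fin n) (Fin n) ℂ)) (Y := ((U 0)⁻¹ : GL (Fin n) ℂ))
    (by simp) (by simp) hNX
    (fun i j h => by
      obtain ⟨k, hk⟩ := hX i j h
      exact (hG _).2 ⟨k, hk.symm⟩)
  -- `κ a` is the frequency with `2πi⟨κ a, ω⟩ = 2 (a - μ a)`; halving `ω` cancels the factor `2`.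
  choose κ hκ using fun a => (hG _).1 (hμ a)
  refine ⟨monomialFrame (fun i => κ (α i)) P, R, torusSmooth_monomialFrame _ _,
    isTrigPolynomial_monomialFrame _ _, fun θ => ?_⟩
  convert hasFlowDerivAt_monomialFrame ((1 / 2 : ℝ) • ω) (fun i => κ (α i)) P θ using 1
  have hfreq : ∀ a, 2 * π * Complex.I * freq ((1 / 2 : ℝ) • ω) (κ a) = a - μ a := by
    intro a
    have h : freq ((1 / 2 : ℝ) • ω) (κ a) = 1 / 2 * freq ω (κ a) := by
      simp only [freq, AddMonoidHom.coe_mk, ZeroHom.coe_mk, Pi.smul_apply, smul_eq_mul,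
        Finset.mul_sum]
      exact Finset.sum_congr rfl fun i _ => by ring
    rw [h]
    push_cast
    linear_combination (1 / 2 : ℂ) * hκ a
  simp only [hfreq]
  set D : Matrix (Fin n) (Fin n) ℂ := Matrix.diagonal fun i => mFourier (κ (α i)) θ with hD
  have hW : (monomialFrame (fun i => κ (α i)) P θ : Matrix (Fin n) (Fin n) ℂ) = D * P := rfl
  -- `κ` depends only on the eigenvalue, so `D` is scalar on each eigenvalue and commutes with `N`.
  have hDM : D * (Matrix.diagonal (fun i => μ (α i)) + N)
      = (Matrix.diagonal (fun i => μ (α i)) + N) * D := by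
    rw [add_mul, mul_add]
    congr 1
    · simp only [hD, Matrix.diagonal_mul_diagonal, mul_comm]
    · ext i j
      rw [hD, Matrix.mul_diagonal, Matrix.diagonal_mul]
      by_cases h : N i j = 0
      · simp [h]
      · rw [(hN i j h).2, mul_comm]
  -- With `P R = M P`, the right side is `(B - M) D P`, and `B - M = diagonal (α - μ ∘ α)`.
  rw [hW, mul_assoc D, hPR, ← mul_assoc D, hDM, mul_assoc, ← sub_mul, add_sub_add_right_eq_sub,
    Matrix.diagonal_sub]

end Main
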